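/- Let $\mathbb{F}$ be a field of prime characteristic $p$ and let $L$ be a finite-dimensional restricted Lie algebra over $\mathbb{F}$ with $[p]$-map $x\mapsto x^{[p]}$. Let $u(L)$ be its restricted universal enveloping algebra, i.e. the quotient of the universal enveloping algebra of $L$ by the two-sided ideal generated by the elements $x^p-x^{[p]}$, $x\in L$. A chief series of $L$ is a chain of ideals $0=L_0\subset L_1\subset\cdots\subset L_n=L$ of the (ordinary) Lie algebra $L$ such that each $L_j/L_{j-1}$ is a minimal non-zero ideal of $L/L_{j-1}$. Let $S=L_j/L_{j-1}$ ($1\le j\le n$) be a factor of a chief series of $L$ which is an abelian Lie algebra, considered as an $L$-module via the adjoint action. Then $S$ is a restricted $L$-module, and as a $u(L)$-module it belongs to the principal block of $u(L)$; that is, there is a primitive idempotent $e$ of the centre of $u(L)$ that acts as the identity on the trivial one-dimensional module $\mathbb{F}$ and also acts as the identity on $S$. -/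

import Mathlib

noncomputable section

namespace RestrictedLie

open scoped Polynomial TensorProduct

/-! ### Restricted Lie algebras -/

section Restricted

variable (p : ℕ) (F L : Type*) [Field F] [LieRing L] [LieAlgebra F L]

/-- The coefficient of `X ^ k` of an element of the polynomial Lie algebra `L[X] = F[X] ⊗ L`. -/
def polyCoeff (k : ℕ) : F[X] ⊗[F] L →ₗ[F] L :=
  (TensorProduct.lid F L).toLinearMap ∘ₗ LinearMap.rTensor L (Polynomial.lcoeff F k)

variable {L} in
/-- Jacobson's elements `s_i(x, y)` for `1 ≤ i ≤ p - 1`: in the Lie algebra `L[X]` one has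
`ad(x X + y)^{p-1}(x) = ∑_{i = 1}^{p-1} i s_i(x, y) X^{i-1}`. -/
def jacobsonS (i : ℕ) (x y : L) : L :=
  (i : F)⁻¹ • polyCoeff F L (i - 1)
    ((LieAlgebra.ad F[X] (F[X] ⊗[F] L)
        ((Polynomial.X : F[X]) ⊗ₜ[F] x + (1 : F[X]) ⊗ₜ[F] y) ^ (p - 1)) ((1 : F[X]) ⊗ₜ[F] x))

/-- A restricted Lie algebra over a field `F` of prime characteristic `p` (Jacobson): a Lie algebra
with a `[p]`-map. -/
class RestrictedLieAlgebra where
  /-- The `[p]`-map `x ↦ x^{[p]}`. -/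
  pMap : L → L
  ad_pMap : ∀ x : L, LieAlgebra.ad F L (pMap x) = LieAlgebra.ad F L x ^ p
  smul_pMap : ∀ (a : F) (x : L), pMap (a • x) = a ^ p • pMap x
  add_pMap : ∀ x y : L,
    pMap (x + y) = pMap x + pMap y + ∑ i ∈ Finset.Icc 1 (p - 1), jacobsonS p F i x y

variable [RestrictedLieAlgebra p F L]

/-- The relations `x ^ p = x^{[p]}`, `x ∈ L`, in the universal enveloping algebra of `L`. -/
inductive EnvelopingRel :
    UniversalEnvelopingAlgebra F L → UniversalEnvelopingAlgebra F L → Prop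
  | pow (x : L) : EnvelopingRel
      (UniversalEnvelopingAlgebra.ι F x ^ p)
      (UniversalEnvelopingAlgebra.ι F (RestrictedLieAlgebra.pMap p F x))

/-- The restricted universal enveloping algebra `u(L)`: the quotient of the universal enveloping
algebra of `L` by the two-sided ideal generated by the elements `x ^ p - x^{[p]}`, `x ∈ L`. -/
def RestrictedEnvelopingAlgebra : Type _ := RingQuot (EnvelopingRel p F L)

instance : Ring (RestrictedEnvelopingAlgebra p F L) :=
  inferInstanceAs (Ring (RingQuot (EnvelopingRel p F L)))

instance : Algebra F (RestrictedEnvelopingAlgebra p F L) :=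
  inferInstanceAs (Algebra F (RingQuot (EnvelopingRel p F L)))

/-! ### Restricted modules and their `u(L)`-module structure -/

section Modules

variable (M : Type*) [AddCommGroup M] [Module F M] [LieRingModule L M] [LieModule F L M]

/-- An `L`-module is restricted if `x^{[p]}` acts as the `p`-th power of the action of `x`. -/
def IsRestrictedModule : Prop :=
  ∀ x : L, LieModule.toEnd F L M (RestrictedLieAlgebra.pMap p F x) = LieModule.toEnd F L M x ^ p

variable {p F L M} in
/-- The representation of `u(L)` on a restricted `L`-module. -/
def IsRestrictedModule.rep (h : IsRestrictedModule p F L M) :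
    RestrictedEnvelopingAlgebra p F L →ₐ[F] Module.End F M :=
  RingQuot.liftAlgHom F (s := EnvelopingRel p F L)
    ⟨UniversalEnvelopingAlgebra.lift F (LieModule.toEnd F L M), by
      rintro _ _ ⟨x⟩
      rw [map_pow, UniversalEnvelopingAlgebra.lift_ι_apply,
        UniversalEnvelopingAlgebra.lift_ι_apply, h x]⟩

end Modules

/-- The one-dimensional trivial `L`-module `F` is restricted. -/
theorem isRestrictedModule_trivial [Fact p.Prime] :
    IsRestrictedModule p F L (TrivialLieModule F L F) := by
  intro x
  have h0 : ∀ y : L, LieModule.toEnd F L (TrivialLieModule F L F) y = 0 := fun y =>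
    LinearMap.ext fun m => LieModule.IsTrivial.trivial y m
  rw [h0, h0, zero_pow (Fact.out : p.Prime).ne_zero]

end Restricted

/-! ### Blocks -/

/-- The block idempotents of a ring `A`, i.e. the primitive idempotents of the centre of `A`; the
blocks of `A` are the two-sided ideals `A e` for block idempotents `e`. -/
structure IsBlockIdempotent {A : Type*} [Ring A] (e : A) : Prop where
  mem_center : e ∈ Subring.center A
  idem : e * e = e
  ne_zero : e ≠ 0
  primitive : ∀ f ∈ Subring.center A, f * f = f → f * e = f → f = 0 ∨ f = e

/-- The `L`-module `M` is a restricted `L`-module belonging to the principal block of `u(L)`, the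
block that contains the trivial irreducible module.  (A `u(L)`-module belongs to the block of the
block idempotent `e` if `e` acts on it as the identity.) -/
def BelongsToPrincipalBlock (p : ℕ) [Fact p.Prime] (F L : Type*) [Field F] [LieRing L]
    [LieAlgebra F L] [RestrictedLieAlgebra p F L]
    (M : Type*) [AddCommGroup M] [Module F M] [LieRingModule L M] [LieModule F L M] : Prop :=
  ∃ h : IsRestrictedModule p F L M, ∃ e : RestrictedEnvelopingAlgebra p F L,
    IsBlockIdempotent e ∧ (isRestrictedModule_trivial p F L).rep e = 1 ∧ h.rep e = 1

/-! ### Chief factors -/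

section Chief

variable {F L : Type*} [Field F] [LieRing L] [LieAlgebra F L]

/-- The projection `L → L / J` as a homomorphism of Lie algebras. -/
def quotientMap (J : LieIdeal F L) : L →ₗ⁅F⁆ L ⧸ J :=
  { (LieSubmodule.Quotient.mk' J : L →ₗ[F] L ⧸ J) with
    map_lie' := fun {_ _} => rfl }

/-- For ideals `J ⊆ I` of `L`, the ideal `I / J` of the Lie algebra `L / J`. -/
def factor (J I : LieIdeal F L) : LieIdeal F (L ⧸ J) := I.map (quotientMap J)

/-- `I / J` as an `L`-module, through `L → L / J`. -/
instance (J I : LieIdeal F L) : LieRingModule L (factor J I) :=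
  LieRingModule.compLieHom (factor J I) (quotientMap J)

instance (J I : LieIdeal F L) : LieModule F L (factor J I) :=
  LieModule.compLieHom (factor J I) (quotientMap J)

variable (F L) in
/-- A chief series `0 = L_0 ⊂ L_1 ⊂ ⋯ ⊂ L_n = L` of `L`: a chain of ideals of `L` such that each
`L_{j+1} / L_j` is a minimal non-zero ideal of `L / L_j`. -/
structure ChiefSeries where
  length : ℕ
  ideal : Fin (length + 1) → LieIdeal F L
  ideal_zero : ideal 0 = ⊥
  ideal_last : ideal (Fin.last length) = ⊤
  le_succ : ∀ j : Fin length, ideal j.castSucc ≤ ideal j.succ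
  minimal : ∀ j : Fin length, IsAtom (factor (ideal j.castSucc) (ideal j.succ))

/-- The chief factor `L_{j+1} / L_j` of a chief series. -/
abbrev ChiefSeries.chiefFactor (C : ChiefSeries F L) (j : Fin C.length) :
    LieIdeal F (L ⧸ C.ideal j.castSucc) :=
  factor (C.ideal j.castSucc) (C.ideal j.succ)

end Chief

end RestrictedLie

end

noncomputable section

namespace RestrictedLie

attribute [local instance] LieRing.ofAssociativeRing LieAlgebra.ofAssociativeAlgebra

/-! ### The restricted universal enveloping algebra -/

section Enveloping

variable (p : ℕ) (F : Type*) {L : Type*} [Field F] [LieRing L] [LieAlgebra F L]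
  [RestrictedLieAlgebra p F L]

/-! Write S = I/J for the factor. `finiteDimensional_envelopingAlgebra` and
`exists_isBlockIdempotent_map_eq_one` give a block idempotent e with augmentation 1, so e fixes the
trivial module. What remains is that e fixes S.

If S contains a non-zero central element of L/J, minimality makes S central; L then acts trivially
on S and e acts by its augmentation.

Otherwise `rep_factor_eq_one` shows that every central e of augmentation 1 fixes S. For each
functional λ on S, `exists_adDerivation_eq_smul` finds polynomials n and n₀ ≠ 0 on copies of L/J
such that n₀ is invariant and each s in S sends n to λ(s)n₀. Let u(L) act on the right by minus
these derivations. Pushing x, with image s in S, to the left through a product gives n·(yx) =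
-λ(y·s)n₀ for all y in u(L), since the correction terms have a factor acting on the invariant n₀.
For y = e, centrality gives n·(ex) = (n·x)·e = -λ(s)n₀, so λ(e·s) = λ(s) for every λ.

To build n, one solves a linear system over the S-invariants by Cramer's rule; a p-th power of the
determinant serves as n₀, because derivations kill p-th powers in characteristic p. -/

/-- The canonical homomorphism from `U(L)` onto `u(L)`. -/
def envelopingMk : UniversalEnvelopingAlgebra F L →ₐ[F] RestrictedEnvelopingAlgebra p F L :=
  RingQuot.mkAlgHom F (EnvelopingRel p F L)

/-- The canonical linear map from `L` to `u(L)`. -/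
def envelopingι : L →ₗ[F] RestrictedEnvelopingAlgebra p F L :=
  (envelopingMk p F).toLinearMap ∘ₗ
    (UniversalEnvelopingAlgebra.ι F : L →ₗ⁅F⁆ UniversalEnvelopingAlgebra F L).toLinearMap

theorem envelopingι_apply (x : L) :
    envelopingι p F x = envelopingMk p F (UniversalEnvelopingAlgebra.ι F x) := rfl

theorem envelopingι_lie (x y : L) :
    envelopingι p F ⁅x, y⁆ =
      envelopingι p F x * envelopingι p F y - envelopingι p F y * envelopingι p F x := by
  simp only [envelopingι_apply, LieHom.map_lie, LieRing.of_associative_ring_bracket, map_sub,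
    map_mul]

theorem envelopingι_pow (x : L) :
    envelopingι p F x ^ p = envelopingι p F (RestrictedLieAlgebra.pMap p F x) := by
  simp only [envelopingι_apply, ← map_pow]
  exact RingQuot.mkAlgHom_rel F (EnvelopingRel.pow x)

/-- By uniqueness in the universal property, lifting into the subalgebra generated by L and then
including it is the identity, so that subalgebra is everything. -/
theorem adjoin_range_universalEnveloping_ι :
    Algebra.adjoin F (Set.range (UniversalEnvelopingAlgebra.ι F : L → _)) = ⊤ := by
  set S := Algebra.adjoin F
    (Set.range (UniversalEnvelopingAlgebra.ι F : L → UniversalEnvelopingAlgebra F L)) with hS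
  let f : L →ₗ⁅F⁆ S :=
    { toFun := fun x => ⟨UniversalEnvelopingAlgebra.ι F x, Algebra.subset_adjoin ⟨x, rfl⟩⟩
      map_add' := fun x y => Subtype.ext (map_add _ x y)
      map_smul' := fun c x => Subtype.ext (map_smul _ c x)
      map_lie' := fun {x y} => Subtype.ext (LieHom.map_lie _ x y) }
  have h : S.val.comp (UniversalEnvelopingAlgebra.lift F f) = AlgHom.id F _ :=
    UniversalEnvelopingAlgebra.hom_ext F (by
      ext x
      exact congrArg S.val (UniversalEnvelopingAlgebra.lift_ι_apply F f x))
  rw [eq_top_iff]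
  intro a _
  rw [← AlgHom.id_apply (R := F) a, ← h]
  exact (UniversalEnvelopingAlgebra.lift F f a).2

theorem adjoin_range_envelopingι :
    Algebra.adjoin F (Set.range (envelopingι p F : L → _)) = ⊤ := by
  have hsurj : Function.Surjective (envelopingMk p F : UniversalEnvelopingAlgebra F L →ₐ[F] _) :=
    RingQuot.mkAlgHom_surjective F _
  rw [← AlgHom.range_eq_top, ← Algebra.map_top, ← adjoin_range_universalEnveloping_ι,
    AlgHom.map_adjoin, ← Set.range_comp] at hsurj
  exact hsurj

variable {p F}

theorem enveloping_induction {P : RestrictedEnvelopingAlgebra p F L → Prop}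
    (ι : ∀ x : L, P (envelopingι p F x)) (algebraMap : ∀ c : F, P (algebraMap F _ c))
    (add : ∀ a b, P a → P b → P (a + b)) (mul : ∀ a b, P a → P b → P (a * b))
    (a : RestrictedEnvelopingAlgebra p F L) : P a := by
  have ha : a ∈ Algebra.adjoin F (Set.range (envelopingι p F : L → _)) := by
    rw [adjoin_range_envelopingι]; trivial
  induction ha using Algebra.adjoin_induction with
  | mem x hx => obtain ⟨x, rfl⟩ := hx; exact ι x
  | algebraMap c => exact algebraMap c
  | add a b _ _ ha hb => exact add a b ha hb
  | mul a b _ _ ha hb => exact mul a b ha hb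

theorem enveloping_hom_ext {A : Type*} [Ring A] [Algebra F A]
    {f g : RestrictedEnvelopingAlgebra p F L →ₐ[F] A}
    (h : ∀ x : L, f (envelopingι p F x) = g (envelopingι p F x)) : f = g :=
  AlgHom.ext fun a => enveloping_induction (P := fun a => f a = g a) h (fun c => by simp)
    (fun a b ha hb => by simp [ha, hb]) (fun a b ha hb => by simp [ha, hb]) a

/-- The universal property of `u(L)`. -/
def envelopingLift {A : Type*} [Ring A] [Algebra F A] (f : L →ₗ⁅F⁆ A)
    (hf : ∀ x, f (RestrictedLieAlgebra.pMap p F x) = f x ^ p) :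
    RestrictedEnvelopingAlgebra p F L →ₐ[F] A :=
  RingQuot.liftAlgHom F (s := EnvelopingRel p F L)
    ⟨UniversalEnvelopingAlgebra.lift F f, by
      rintro _ _ ⟨x⟩
      rw [map_pow, UniversalEnvelopingAlgebra.lift_ι_apply,
        UniversalEnvelopingAlgebra.lift_ι_apply, hf x]⟩

theorem envelopingLift_ι {A : Type*} [Ring A] [Algebra F A] (f : L →ₗ⁅F⁆ A)
    (hf : ∀ x, f (RestrictedLieAlgebra.pMap p F x) = f x ^ p) (x : L) :
    envelopingLift f hf (envelopingι p F x) = f x :=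
  (RingQuot.liftAlgHom_mkAlgHom_apply _ _ _ _).trans (UniversalEnvelopingAlgebra.lift_ι_apply _ _ _)

theorem IsRestrictedModule.rep_ι {M : Type*} [AddCommGroup M] [Module F M] [LieRingModule L M]
    [LieModule F L M] (h : IsRestrictedModule p F L M) (x : L) :
    h.rep (envelopingι p F x) = LieModule.toEnd F L M x :=
  (RingQuot.liftAlgHom_mkAlgHom_apply _ _ _ _).trans (UniversalEnvelopingAlgebra.lift_ι_apply _ _ _)

variable (p F L) in
/-- The augmentation of `u(L)`. -/
def augmentation [Fact p.Prime] : RestrictedEnvelopingAlgebra p F L →ₐ[F] F :=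
  envelopingLift 0 fun _ => (zero_pow (Fact.out : p.Prime).ne_zero).symm

@[simp]
theorem augmentation_ι [Fact p.Prime] (x : L) : augmentation p F L (envelopingι p F x) = 0 :=
  envelopingLift_ι _ _ x

theorem IsRestrictedModule.rep_eq_augmentation [Fact p.Prime] {M : Type*} [AddCommGroup M]
    [Module F M] [LieRingModule L M] [LieModule F L M] (h : IsRestrictedModule p F L M)
    (htriv : ∀ (x : L) (m : M), ⁅x, m⁆ = 0) (a : RestrictedEnvelopingAlgebra p F L) :
    h.rep a = algebraMap F _ (augmentation p F L a) := by
  have : h.rep = (Algebra.ofId F (Module.End F M)).comp (augmentation p F L) :=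
    enveloping_hom_ext fun x => by
      rw [h.rep_ι, AlgHom.comp_apply, augmentation_ι, map_zero]
      exact LinearMap.ext (htriv x)
  rw [this]; rfl

end Enveloping

/-! ### Finite-dimensionality of the restricted universal enveloping algebra -/

section Finite

/-- If a subspace `V` is closed under commutators, then products of elements of `V`
may be permuted modulo shorter products. -/
theorem list_prod_sub_mem_of_perm {F A : Type*} [Field F] [Ring A] [Algebra F A]
    (V : Submodule F A) (hV : ∀ a ∈ V, ∀ b ∈ V, a * b - b * a ∈ V) {l l' : List A}
    (h : l.Perm l') (hl : ∀ a ∈ l, a ∈ V) : l.prod - l'.prod ∈ V ^ (l.length - 1) := by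
  have hprod : ∀ l : List A, (∀ a ∈ l, a ∈ V) → l.prod ∈ V ^ l.length := by
    intro l
    induction l with
    | nil => intro _; simp [Submodule.one_le.1 le_rfl]
    | cons a l ih =>
      intro h
      rw [List.prod_cons, List.length_cons, pow_succ']
      exact Submodule.mul_mem_mul (h a (by simp)) (ih fun b hb => h b (by simp [hb]))
  induction h with
  | nil => simp
  | @cons a l l' h ih =>
    rw [List.prod_cons, List.prod_cons, ← mul_sub, List.length_cons, Nat.add_sub_cancel]
    have h0 := Submodule.mul_mem_mul (hl a (by simp)) (ih fun b hb => hl b (by simp [hb]))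
    rw [← pow_succ'] at h0
    rcases Nat.eq_zero_or_pos l.length with h' | h'
    · rw [List.length_eq_zero_iff] at h'
      subst h'
      rw [List.nil_perm] at h
      subst h
      simp
    · rwa [Nat.sub_add_cancel h'] at h0
  | swap a b l =>
    have h0 := Submodule.mul_mem_mul (hV b (hl b (by simp)) a (hl a (by simp)))
      (hprod l fun c hc => hl c (by simp [hc]))
    rw [← pow_succ'] at h0
    simpa [sub_mul, mul_assoc] using h0
  | trans h₁ h₂ ih₁ ih₂ =>
    have h3 := add_mem (ih₁ hl) (h₁.length_eq ▸ ih₂ fun a ha => hl a (h₁.mem_iff.2 ha))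
    simpa using h3

theorem exists_le_count {n p : ℕ} (l : List (Fin n)) (hl : n * p < l.length) :
    ∃ i, p ≤ l.count i := by
  by_contra! h
  have h1 : ∑ i : Fin n, l.count i = l.length := by
    have := Multiset.sum_count_eq_card (s := Finset.univ) (m := (l : Multiset (Fin n))) (by simp)
    simpa using this
  have h2 : ∑ i : Fin n, l.count i ≤ ∑ _i : Fin n, p := Finset.sum_le_sum fun i _ => (h i).le
  simp at h2
  omega

variable (p : ℕ) (F L : Type*) [Field F] [LieRing L] [LieAlgebra F L]
  [RestrictedLieAlgebra p F L]

/-- The subspace `F + L` of `u(L)`. -/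
def envelopingOne : Submodule F (RestrictedEnvelopingAlgebra p F L) :=
  1 ⊔ LinearMap.range (envelopingι p F)

variable {F L}

theorem one_mem_envelopingOne : (1 : RestrictedEnvelopingAlgebra p F L) ∈ envelopingOne p F L :=
  Submodule.mem_sup_left (Submodule.one_le.1 le_rfl)

theorem ι_mem_envelopingOne (x : L) : envelopingι p F x ∈ envelopingOne p F L :=
  Submodule.mem_sup_right ⟨x, rfl⟩

variable (F L)

theorem envelopingOne_commutator (a) (ha : a ∈ envelopingOne p F L) (b)
    (hb : b ∈ envelopingOne p F L) : a * b - b * a ∈ envelopingOne p F L := by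
  obtain ⟨_, h, _, ⟨x, rfl⟩, rfl⟩ := Submodule.mem_sup.1 ha
  obtain ⟨c, rfl⟩ := Submodule.mem_one.1 h
  obtain ⟨_, h, _, ⟨y, rfl⟩, rfl⟩ := Submodule.mem_sup.1 hb
  obtain ⟨d, rfl⟩ := Submodule.mem_one.1 h
  have := ι_mem_envelopingOne p (F := F) ⁅x, y⁆
  rw [envelopingι_lie] at this
  convert this using 1
  have h1 := Algebra.commutes c (envelopingι p F y)
  have h2 := Algebra.commutes d (envelopingι p F x)
  have h3 := Algebra.commutes c (algebraMap F (RestrictedEnvelopingAlgebra p F L) d)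
  rw [add_mul, mul_add, mul_add, add_mul, mul_add, mul_add, h1, h2, h3]
  abel

theorem envelopingOne_mono :
    Monotone (fun n => (envelopingOne p F L) ^ n) := fun _ _ hmn =>
  pow_le_pow_right₀ (Submodule.one_le.2 (one_mem_envelopingOne p)) hmn

variable [Fact p.Prime] [FiniteDimensional F L]

/-- A word of length `n * p + 1` in 1 and the basis either contains 1 or repeats a basis element p
times. Reordering costs only shorter words; then 1 is dropped, or the p equal factors collapse to
one element of L by the defining relation. -/
theorem envelopingOne_pow_le :
    envelopingOne p F L ^ (Module.finrank F L * p + 1) ≤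
      envelopingOne p F L ^ (Module.finrank F L * p) := by
  set V := envelopingOne p F L
  set n := Module.finrank F L
  have hp := (Fact.out : p.Prime)
  let b : Module.Basis (Fin n) F L := Module.finBasis F L
  let g : Option (Fin n) → RestrictedEnvelopingAlgebra p F L := fun o =>
    o.elim 1 fun i => envelopingι p F (b i)
  have hV : V = Submodule.span F (Set.range g) := by
    have h1 : Set.range g = {1} ∪ envelopingι p F '' Set.range b := by
      ext a
      simp [g, Option.exists, @eq_comm _ _ a]
    rw [h1, Submodule.span_union, ← Submodule.map_span, b.span_eq, Submodule.map_top,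
      ← Submodule.one_eq_span]
    rfl
  have hmono := envelopingOne_mono p F L
  have hg : ∀ o, g o ∈ V := fun o => hV ▸ Submodule.subset_span ⟨o, rfl⟩
  have hprod : ∀ l : List (Option (Fin n)), (l.map g).prod ∈ V ^ l.length := by
    intro l
    induction l with
    | nil => simp [Submodule.one_le.1 le_rfl]
    | cons a l ih =>
      rw [List.map_cons, List.prod_cons, List.length_cons, pow_succ']
      exact Submodule.mul_mem_mul (hg a) ih
  have hword : ∀ l : List (Option (Fin n)), l.length = n * p + 1 →
      (l.map g).prod ∈ V ^ (n * p) := by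
    intro l hl
    have hperm : ∀ l', l.Perm l' → (l'.map g).prod ∈ V ^ (n * p) →
        (l.map g).prod ∈ V ^ (n * p) := by
      intro l' h h'
      have h3 := list_prod_sub_mem_of_perm V (envelopingOne_commutator p F L) (h.map g)
        (by intro a ha; obtain ⟨o, _, rfl⟩ := List.mem_map.1 ha; exact hg o)
      rw [List.length_map, hl, Nat.add_sub_cancel] at h3
      simpa using add_mem h3 h'
    by_cases hnone : none ∈ l
    · refine hperm _ (List.perm_cons_erase hnone) ?_
      have h4 := hprod (l.erase none)
      rw [List.length_erase_of_mem hnone, hl, Nat.add_sub_cancel] at h4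
      simpa [g] using h4
    · obtain ⟨m, rfl⟩ : l ∈ Set.range (List.map (some : Fin n → Option (Fin n))) := by
        rw [Set.range_list_map]
        rintro (_ | i) ho
        · exact absurd ho hnone
        · exact ⟨i, rfl⟩
      rw [List.length_map] at hl
      obtain ⟨i, hi⟩ := exists_le_count (p := p) m (by omega)
      obtain ⟨r, hr⟩ := (List.replicate_sublist_iff.2 hi).exists_perm_append
      refine hperm _ (hr.map some) ?_
      have hlen := hr.length_eq
      rw [List.length_append, List.length_replicate] at hlen
      rw [List.map_append, List.map_append, List.prod_append, List.map_replicate,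
        List.map_replicate, List.prod_replicate]
      have h5 : g (some i) ^ p ∈ V := by
        simp only [g, Option.elim, envelopingι_pow]
        exact ι_mem_envelopingOne p _
      have h6 := Submodule.mul_mem_mul h5 (hprod (r.map some))
      rw [← pow_succ', List.length_map] at h6
      exact hmono (by have := hp.two_le; omega) h6
  have hspan : ∀ m, V ^ m ≤ Submodule.span F
      {a | ∃ l : List (Option (Fin n)), l.length = m ∧ a = (l.map g).prod} := by
    intro m
    induction m with
    | zero =>
      rw [pow_zero, Submodule.one_eq_span]
      exact Submodule.span_mono (by rintro _ rfl; exact ⟨[], rfl, rfl⟩)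
    | succ m ih =>
      rw [pow_succ']
      refine (mul_le_mul' hV.le ih).trans ?_
      rw [Submodule.span_mul_span]
      refine Submodule.span_mono ?_
      rintro _ ⟨_, ⟨o, rfl⟩, _, ⟨l, hl, rfl⟩, rfl⟩
      exact ⟨o :: l, by simp [hl], by simp⟩
  refine (hspan _).trans (Submodule.span_le.2 ?_)
  rintro _ ⟨l, hl, rfl⟩
  exact hword l hl

/-- The increasing powers of F + L exhaust u(L) and stop growing at exponent N. Only this spanning
bound is needed, not linear independence of monomials. -/
instance finiteDimensional_envelopingAlgebra :
    FiniteDimensional F (RestrictedEnvelopingAlgebra p F L) := by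
  set N := Module.finrank F L * p
  have hmono := envelopingOne_mono p F L
  have hle : ∀ k, envelopingOne p F L ^ (N + k) ≤ envelopingOne p F L ^ N := by
    intro k
    induction k with
    | zero => exact le_rfl
    | succ k ih =>
      rw [← add_assoc, pow_succ']
      refine (mul_le_mul' le_rfl ih).trans ?_
      rw [← pow_succ']
      exact envelopingOne_pow_le p F L
  have hfin : (envelopingOne p F L).FG :=
    Submodule.FG.sup (by rw [Submodule.one_eq_span]; exact Submodule.fg_span_singleton _)
      (LinearMap.range_eq_map (envelopingι p F (L := L)) ▸ Module.Finite.fg_top.map _)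
  have htop : envelopingOne p F L ^ N = ⊤ := by
    rw [eq_top_iff]
    rintro a -
    obtain ⟨k, hk⟩ : ∃ k, a ∈ envelopingOne p F L ^ k := by
      induction a using enveloping_induction with
      | ι x => exact ⟨1, by rw [pow_one]; exact ι_mem_envelopingOne p x⟩
      | algebraMap c => exact ⟨0, by rw [pow_zero]; exact Submodule.mem_one.2 ⟨c, rfl⟩⟩
      | add a b ha hb =>
        obtain ⟨k, hk⟩ := ha
        obtain ⟨l, hl⟩ := hb
        exact ⟨max k l, add_mem (hmono (le_max_left k l) hk) (hmono (le_max_right k l) hl)⟩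
      | mul a b ha hb =>
        obtain ⟨k, hk⟩ := ha
        obtain ⟨l, hl⟩ := hb
        exact ⟨k + l, by rw [pow_add]; exact Submodule.mul_mem_mul hk hl⟩
    exact hle k (hmono (Nat.le_add_left k N) hk)
  exact Module.finite_def.2 (htop ▸ hfin.pow N)

end Finite

/-! ### Existence of block idempotents -/

/-- A finite-dimensional algebra with an augmentation has a block idempotent on which the
augmentation does not vanish. -/
theorem exists_isBlockIdempotent_map_eq_one {F A : Type*} [Field F] [Ring A] [Algebra F A]
    [FiniteDimensional F A] (ε : A →ₐ[F] F) : ∃ e : A, IsBlockIdempotent e ∧ ε e = 1 := by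
  let Q : A → Prop := fun e => e ∈ Subring.center A ∧ e * e = e ∧ ε e = 1
  let d : A → ℕ := fun e => Module.finrank F (LinearMap.range (LinearMap.mulLeft F e))
  have hQ1 : Q 1 := ⟨one_mem _, one_mul 1, map_one ε⟩
  -- Among central idempotents of augmentation 1, choose e with eA of least dimension.
  obtain ⟨e, ⟨hec, hei, hee⟩, hmin⟩ :=
    WellFounded.has_min (InvImage.wf d Nat.lt_wfRel.wf) {e | Q e} ⟨1, hQ1⟩
  have key : ∀ f, Q f → f * e = f → f = e := by
    intro f hf hfe
    have hcomm : e * f = f := by rw [← Subring.mem_center_iff.1 hec f, hfe]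
    have hle : LinearMap.range (LinearMap.mulLeft F f) ≤ LinearMap.range (LinearMap.mulLeft F e) := by
      rintro _ ⟨a, rfl⟩
      exact ⟨f * a, by simp [← mul_assoc, hcomm]⟩
    have heq := Submodule.eq_of_le_of_finrank_le hle (not_lt.1 (hmin f hf))
    obtain ⟨a, ha⟩ : e ∈ LinearMap.range (LinearMap.mulLeft F f) := by
      rw [heq]; exact ⟨1, by simp⟩
    rw [LinearMap.mulLeft_apply] at ha
    rw [← hfe, ← ha, ← mul_assoc, hf.2.1]
  refine ⟨e, ⟨hec, hei, ?_, ?_⟩, hee⟩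
  · rintro rfl
    simp at hee
  · intro f hf hfi hfe
    have hcomm : e * f = f := by rw [← Subring.mem_center_iff.1 hec f, hfe]
    have hε : ε f * ε f = ε f := by rw [← map_mul, hfi]
    -- One of f and e - f has augmentation 1, and by minimality it equals e.
    rcases IsIdempotentElem.iff_eq_zero_or_one.1 hε with h | h
    · left
      have := key (e - f) ⟨sub_mem hec hf, by simp [sub_mul, mul_sub, hei, hfi, hfe, hcomm],
        by simp [hee, h]⟩ (by simp [sub_mul, hei, hfe])
      simpa using this
    · exact Or.inr (key f ⟨hf, hfi, h⟩ hfe)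

/-! ### Derivations in characteristic `p` -/

/-- In characteristic `p` the `p`-th power of a derivation satisfies the Leibniz rule. -/
theorem derivation_pow_char_leibniz (p : ℕ) [Fact p.Prime] {F N : Type*} [Field F] [CharP F p]
    [CommRing N] [Algebra F N] (D : Derivation F N N) (f g : N) :
    ((D : N →ₗ[F] N) ^ p) (f * g) =
      f • ((D : N →ₗ[F] N) ^ p) g + g • ((D : N →ₗ[F] N) ^ p) f := by
  set T : Module.End F N := (D : N →ₗ[F] N) with hT
  rcases subsingleton_or_nontrivial N with _ | _
  · exact Subsingleton.elim _ _
  have : CharP (Module.End F (Module.End F N)) p :=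
    charP_of_injective_algebraMap (algebraMap F _).injective p
  -- The commutator with T turns multiplication by f into multiplication by T f. In characteristic p
  -- the p-th power of this commutator map is the commutator with T ^ p.
  have hpow : ∀ (k : ℕ) (f : N), ((LinearMap.mulLeft F T - LinearMap.mulRight F T) ^ k)
      (LinearMap.mulLeft F f) = LinearMap.mulLeft F ((T ^ k) f) := by
    intro k
    induction k with
    | zero => intro f; simp
    | succ k ih =>
      intro f
      rw [pow_succ, Module.End.mul_apply, pow_succ, Module.End.mul_apply, ← ih]
      congr 1
      ext h
      simp [hT, mul_comm]
  have h := hpow p f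
  rw [sub_pow_char_of_commute _ (LinearMap.commute_mulLeft_right T T), LinearMap.pow_mulLeft,
    LinearMap.pow_mulRight] at h
  have h2 := LinearMap.congr_fun h g
  simp only [LinearMap.sub_apply, LinearMap.mulLeft_apply, LinearMap.mulRight_apply,
    Module.End.mul_apply] at h2
  rw [sub_eq_iff_eq_add] at h2
  rw [h2, smul_eq_mul, smul_eq_mul, add_comm, mul_comm g]

/-- The `p`-th power of a derivation in characteristic `p`. -/
def derivationPowChar (p : ℕ) [Fact p.Prime] {F N : Type*} [Field F] [CharP F p]
    [CommRing N] [Algebra F N] (D : Derivation F N N) : Derivation F N N :=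
  Derivation.mk' ((D : N →ₗ[F] N) ^ p) (derivation_pow_char_leibniz p D)

/-! ### The action of a Lie algebra on the symmetric algebra of copies of its adjoint module -/

section Symmetric

variable {F Q ι κ : Type*} [Field F] [LieRing Q] [LieAlgebra F Q] (b : Module.Basis ι F Q)

variable (κ) in
/-- The polynomial ring on `κ` copies of a basis of `Q`, i.e. the symmetric algebra of `Q ^ κ`. -/
abbrev CopiesRing (_ : Module.Basis ι F Q) : Type _ := MvPolynomial (κ × ι) F

/-- The embedding of the copy of `Q` with index `l` as linear forms. -/
def copy (l : κ) : Q →ₗ[F] CopiesRing κ b :=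
  b.constr F fun i => MvPolynomial.X (l, i)

theorem copy_basis (l : κ) (i : ι) : copy b l (b i) = MvPolynomial.X (l, i) :=
  b.constr_basis F _ i

variable (κ) in
/-- The derivation extending the adjoint action of an element on each copy of `Q`. -/
def adDerivation (x : Q) : Derivation F (CopiesRing κ b) (CopiesRing κ b) :=
  MvPolynomial.mkDerivation F fun li => copy b li.1 ⁅x, b li.2⁆

theorem adDerivation_X (x : Q) (l : κ) (i : ι) :
    adDerivation κ b x (MvPolynomial.X (l, i)) = copy b l ⁅x, b i⁆ :=
  MvPolynomial.mkDerivation_X _ _ _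

theorem adDerivation_copy (x : Q) (l : κ) (w : Q) :
    adDerivation κ b x (copy b l w) = copy b l ⁅x, w⁆ := by
  have : (adDerivation κ b x : CopiesRing κ b →ₗ[F] CopiesRing κ b) ∘ₗ copy b l =
      copy b l ∘ₗ (LieAlgebra.ad F Q x : Q →ₗ[F] Q) :=
    b.ext fun i => by simp [copy_basis, adDerivation_X]
  exact LinearMap.congr_fun this w

variable (κ) in
/-- The action of `Q` by derivations as a linear map. -/
def adDerivationₗ : Q →ₗ[F] Module.End F (CopiesRing κ b) where
  toFun x := (adDerivation κ b x : CopiesRing κ b →ₗ[F] CopiesRing κ b)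
  map_add' x y := by
    have : adDerivation κ b (x + y) = adDerivation κ b x + adDerivation κ b y :=
      MvPolynomial.derivation_ext fun ⟨l, i⟩ => by simp [adDerivation_X]
    rw [this]; rfl
  map_smul' c x := by
    have : adDerivation κ b (c • x) = c • adDerivation κ b x :=
      MvPolynomial.derivation_ext fun ⟨l, i⟩ => by simp [adDerivation_X]
    rw [this]; rfl

@[simp]
theorem adDerivationₗ_apply (x : Q) (f : CopiesRing κ b) :
    adDerivationₗ κ b x f = adDerivation κ b x f := rfl

theorem adDerivationₗ_lie (x y : Q) :
    adDerivationₗ κ b ⁅x, y⁆ =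
      adDerivationₗ κ b x * adDerivationₗ κ b y - adDerivationₗ κ b y * adDerivationₗ κ b x := by
  have : adDerivation κ b ⁅x, y⁆ = ⁅adDerivation κ b x, adDerivation κ b y⁆ :=
    MvPolynomial.derivation_ext fun ⟨l, i⟩ => by
      simp [adDerivation_X, adDerivation_copy, Derivation.commutator_apply, lie_lie]
  refine LinearMap.ext fun f => ?_
  have := Derivation.congr_fun this f
  rwa [Derivation.commutator_apply] at this

theorem adDerivationₗ_pow_copy (x : Q) (k : ℕ) (l : κ) (w : Q) :
    (adDerivationₗ κ b x ^ k) (copy b l w) = copy b l ((LieAlgebra.ad F Q x ^ k) w) := by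
  induction k generalizing w with
  | zero => simp
  | succ k ih =>
    rw [pow_succ, Module.End.mul_apply, adDerivationₗ_apply, adDerivation_copy, ih, pow_succ,
      Module.End.mul_apply, LieAlgebra.ad_apply]

/-- Both sides are derivations, the right one because p-th powers of derivations are derivations
here, so agreement on the variables suffices. -/
theorem adDerivationₗ_eq_pow (p : ℕ) [Fact p.Prime] [CharP F p] {x y : Q}
    (h : LieAlgebra.ad F Q y = LieAlgebra.ad F Q x ^ p) :
    adDerivationₗ κ b y = adDerivationₗ κ b x ^ p := by
  have : adDerivation κ b y = derivationPowChar p (adDerivation κ b x) :=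
    MvPolynomial.derivation_ext fun ⟨l, i⟩ => by
      rw [adDerivation_X, ← LieAlgebra.ad_apply (R := F), h, ← adDerivationₗ_pow_copy, copy_basis]
      rfl
  refine LinearMap.ext fun f => ?_
  exact Derivation.congr_fun this f

end Symmetric

/-! ### Invariants of an abelian ideal and the polynomials n, n₀ -/

/-- The common kernel of a set of derivations. -/
def derivationKernel {F N : Type*} [Field F] [CommRing N] [Algebra F N]
    (T : Set (Derivation F N N)) : Subalgebra F N where
  carrier := {f | ∀ D ∈ T, D f = 0}
  mul_mem' hf hg D hD := by simp [hf D hD, hg D hD]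
  add_mem' hf hg D hD := by simp [hf D hD, hg D hD]
  algebraMap_mem' c D _ := D.map_algebraMap c

/-- If no non-zero element of the abelian ideal `S` is central in `Q` then the dual of `S` has a
basis of functionals `s ↦ ξ ⁅s, z⁆`. -/
theorem exists_basis_dual_lie {F Q : Type*} [Field F] [LieRing Q] [LieAlgebra F Q]
    [FiniteDimensional F Q] (S : LieIdeal F Q)
    (hS : ∀ s ∈ S, (∀ w : Q, ⁅s, w⁆ = 0) → s = 0) :
    ∃ (r : ℕ) (a : Module.Basis (Fin r) F S) (z : Fin r → Q) (ξ : Fin r → Q →ₗ[F] F),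
      ∀ i l, ξ l ⁅(a i : Q), z l⁆ = if l = i then 1 else 0 := by
  let T : Set (Module.Dual F S) :=
    {η | ∃ (z : Q) (ξ : Q →ₗ[F] F), ∀ s : S, η s = ξ ⁅(s : Q), z⁆}
  have hT : Submodule.span F T = ⊤ := by
    -- By duality it is enough that the functionals in T have no common zero; a common zero would be
    -- central.
    rw [← Subspace.dualCoannihilator_dualAnnihilator_eq (W := Submodule.span F T)]
    suffices h : (Submodule.span F T).dualCoannihilator = ⊥ by
      rw [h, Submodule.dualAnnihilator_bot]
    rw [eq_bot_iff]
    intro s hs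
    rw [Submodule.mem_dualCoannihilator] at hs
    refine Subtype.ext (hS s s.2 fun w => ?_)
    rw [← Module.forall_dual_apply_eq_zero_iff F]
    intro ξ
    exact hs (ξ ∘ₗ (LieModule.toEnd F Q Q).toLinearMap.flip w ∘ₗ S.toSubmodule.subtype)
      (Submodule.subset_span ⟨w, ξ, fun _ => rfl⟩)
  obtain ⟨κ, hκT, hκ, hind⟩ := exists_linearIndependent F T
  let B₀ : Module.Basis κ F (Module.Dual F S) :=
    Module.Basis.mk hind (by rw [Subtype.range_coe, hκ, hT])
  have : Finite κ := Module.Finite.finite_basis B₀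
  let B := B₀.reindex (Finite.equivFin κ)
  have hB : ∀ l, B l ∈ T := fun l => by
    simp only [B, B₀, Module.Basis.reindex_apply, Module.Basis.mk_apply]
    exact hκT (Subtype.prop _)
  choose z ξ hzξ using hB
  refine ⟨_, B.dualBasis.map (Module.evalEquiv F S).symm, z, ξ, fun i l => ?_⟩
  rw [← hzξ, Module.Basis.map_apply, Module.apply_evalEquiv_symm_apply,
    Module.Basis.dualBasis_apply_self]

/-- There is an element of the symmetric algebra which every `s ∈ S` maps to
`lam s` times a fixed non-zero invariant. -/
theorem exists_adDerivation_eq_smul (p : ℕ) [Fact p.Prime] {F Q ι : Type*} [Field F] [CharP F p]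
    [LieRing Q] [LieAlgebra F Q] [FiniteDimensional F Q] (b : Module.Basis ι F Q)
    (S : LieIdeal F Q) (hab : ∀ s ∈ S, ∀ t ∈ S, ⁅s, t⁆ = 0)
    (hS : ∀ s ∈ S, (∀ w : Q, ⁅s, w⁆ = 0) → s = 0) (lam : S →ₗ[F] F) :
    ∃ (r : ℕ) (n n₀ : CopiesRing (Fin r) b), n₀ ≠ 0 ∧ (∀ x, adDerivation (Fin r) b x n₀ = 0) ∧
      ∀ s : S, adDerivation (Fin r) b (s : Q) n = lam s • n₀ := by
  obtain ⟨r, a, z, ξ, hξ⟩ := exists_basis_dual_lie S hS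
  let K : Subalgebra F (CopiesRing (Fin r) b) :=
    derivationKernel (Set.range fun s : S => adDerivation (Fin r) b (s : Q))
  have hK : ∀ (f : K) (s : S), adDerivation (Fin r) b (s : Q) (f : CopiesRing (Fin r) b) = 0 :=
    fun f s => f.2 _ ⟨s, rfl⟩
  -- Since S is an abelian ideal, each bracket with `a i` lies in S and is killed by S, so the
  -- entries are S-invariant.
  let M : Matrix (Fin r) (Fin r) K := fun i l => ⟨copy b l ⁅(a i : Q), z l⁆, by
    rintro _ ⟨s, rfl⟩
    simp only
    rw [adDerivation_copy, hab _ s.2 _ (lie_mem_left F Q S _ _ (a i).2), map_zero]⟩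
  let v : Fin r → K := fun i => algebraMap F K (lam (a i))
  -- Cramer's rule solves M c = det M · v without inverting the determinant.
  let c : Fin r → K := M.cramer v
  have hc : ∀ i, ∑ l, M i l * c l = M.det * v i := fun i =>
    congrFun (Matrix.mulVec_cramer M v) i
  let δ : CopiesRing (Fin r) b := (M.det : K)
  have hδ : δ ≠ 0 := by
    -- Evaluating the l-th copy at `ξ l` turns M into the identity matrix. This is why a separate
    -- copy of Q is used for each l.
    let φ : CopiesRing (Fin r) b →ₐ[F] F := MvPolynomial.aeval fun li => ξ li.1 (b li.2)
    have hφ : ∀ l w, φ (copy b l w) = ξ l w := by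
      intro l w
      have : φ.toLinearMap ∘ₗ copy b l = ξ l :=
        b.ext fun i => by simp [copy_basis, φ]
      exact LinearMap.congr_fun this w
    have h1 : (φ.comp K.val) M.det = 1 := by
      rw [AlgHom.map_det, ← Matrix.det_one (n := Fin r)]
      congr 1
      ext i l
      rw [AlgHom.mapMatrix_apply, Matrix.map_apply, Matrix.one_apply]
      exact ((hφ l _).trans (hξ i l)).trans (if_congr eq_comm rfl rfl)
    intro h0
    rw [AlgHom.comp_apply] at h1
    change φ δ = 1 at h1
    rw [h0, map_zero] at h1
    exact zero_ne_one h1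
  -- Without the factor `δ ^ (p - 1)`, `a i` would yield λ(a i)δ, where δ is invariant under S only;
  -- the p-th power is invariant under all of Q.
  refine ⟨r, δ ^ (p - 1) * ∑ l, (c l : CopiesRing (Fin r) b) * copy b l (z l), δ ^ p,
    pow_ne_zero _ hδ, fun x => ?_, fun s => ?_⟩
  · rw [Derivation.leibniz_pow, ← Nat.cast_smul_eq_nsmul F, CharP.cast_eq_zero, zero_smul]
  · have key : ∀ i, adDerivation (Fin r) b (a i : Q)
        (δ ^ (p - 1) * ∑ l, (c l : CopiesRing (Fin r) b) * copy b l (z l)) = lam (a i) • δ ^ p := by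
      intro i
      have h2 := congrArg K.val (hc i)
      simp only [map_sum, map_mul, Subalgebra.coe_val, M, v] at h2
      rw [Derivation.leibniz, Derivation.leibniz_pow, hK M.det (a i), map_sum]
      simp only [Derivation.leibniz, hK, adDerivation_copy, smul_eq_mul, mul_zero, smul_zero, add_zero]
      have h3 : ∀ l, (c l : CopiesRing (Fin r) b) * copy b l ⁅(a i : Q), z l⁆ =
        copy b l ⁅(a i : Q), z l⁆ * c l := fun l => mul_comm _ _
      simp only [h3]
      rw [h2]
      change δ ^ (p - 1) * (δ * algebraMap F _ (lam (a i))) = _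
      rw [← mul_assoc, ← pow_succ, Nat.sub_add_cancel (Fact.out : p.Prime).one_le,
        Algebra.smul_def, mul_comm]
    have hlin : (LinearMap.applyₗ (R := F)
        (δ ^ (p - 1) * ∑ l, (c l : CopiesRing (Fin r) b) * copy b l (z l))) ∘ₗ adDerivationₗ (Fin r) b ∘ₗ
        S.toSubmodule.subtype = lam.smulRight (δ ^ p) := a.ext fun i => key i
    exact LinearMap.congr_fun hlin s

/-! ### Abelian factors and central idempotents -/

section Main

variable {p : ℕ} {F L : Type*} [Field F] [LieRing L] [LieAlgebra F L]

theorem quotientMap_surjective (J : LieIdeal F L) : Function.Surjective (quotientMap J) :=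
  LieSubmodule.Quotient.surjective_mk' J

theorem coe_lie_factor (J I : LieIdeal F L) (x : L) (s : factor J I) :
    ((⁅x, s⁆ : factor J I) : L ⧸ J) = ⁅quotientMap J x, (s : L ⧸ J)⁆ := rfl

variable [RestrictedLieAlgebra p F L]

/-- J need not be stable under the `[p]`-map, so L/J has no induced one in general; the identity for
`ad` still descends from L. -/
theorem ad_quotientMap_pMap (J : LieIdeal F L) (x : L) :
    LieAlgebra.ad F (L ⧸ J) (quotientMap J (RestrictedLieAlgebra.pMap p F x)) =
      LieAlgebra.ad F (L ⧸ J) (quotientMap J x) ^ p := by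
  have hpow : ∀ (k : ℕ) (y : L), (LieAlgebra.ad F (L ⧸ J) (quotientMap J x) ^ k)
      (quotientMap J y) = quotientMap J ((LieAlgebra.ad F L x ^ k) y) := by
    intro k
    induction k with
    | zero => intro y; simp
    | succ k ih =>
      intro y
      rw [pow_succ, Module.End.mul_apply, LieAlgebra.ad_apply, ← LieHom.map_lie, ih, pow_succ,
        Module.End.mul_apply, LieAlgebra.ad_apply]
  refine LinearMap.ext fun q => ?_
  obtain ⟨y, rfl⟩ := quotientMap_surjective J q
  rw [hpow, ← RestrictedLieAlgebra.ad_pMap, LieAlgebra.ad_apply, LieAlgebra.ad_apply,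
    LieHom.map_lie]

variable (p) in
theorem isRestrictedModule_factor (J I : LieIdeal F L) :
    IsRestrictedModule p F L (factor J I) := by
  intro x
  have hpow : ∀ (k : ℕ) (s : factor J I),
      (((LieModule.toEnd F L (factor J I) x ^ k) s : factor J I) : L ⧸ J) =
        (LieAlgebra.ad F (L ⧸ J) (quotientMap J x) ^ k) (s : L ⧸ J) := by
    intro k
    induction k with
    | zero => intro s; simp
    | succ k ih =>
      intro s
      rw [pow_succ, Module.End.mul_apply, ih, pow_succ, Module.End.mul_apply]
      rfl
  refine LinearMap.ext fun s => Subtype.ext ?_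
  rw [hpow, ← ad_quotientMap_pMap]
  rfl

/-! ### The right action of u(L) on polynomials and its comparison with S -/

variable [Fact p.Prime] [CharP F p]

theorem neg_mul_sub_mul_comm {R : Type*} [Ring R] (a b : R) :
    -(a * b - b * a) = -b * -a - -a * -b := by
  rw [neg_mul_neg, neg_mul_neg, neg_sub]

/-- The right action of `u(L)` on the symmetric algebra of copies of `L / J`, where `x ∈ L` acts by
minus the derivation extending its adjoint action. -/
def rightAdAction {ι : Type*} (κ : Type*) (J : LieIdeal F L) (b : Module.Basis ι F (L ⧸ J)) :
    RestrictedEnvelopingAlgebra p F L →ₐ[F] (Module.End F (CopiesRing κ b))ᵐᵒᵖ :=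
  envelopingLift
    { (-((MulOpposite.opLinearEquiv F).toLinearMap ∘ₗ adDerivationₗ κ b ∘ₗ
        (quotientMap J : L →ₗ[F] L ⧸ J)) : L →ₗ[F] (Module.End F (CopiesRing κ b))ᵐᵒᵖ) with
      map_lie' := fun {x y} => by
        apply MulOpposite.unop_injective
        change -adDerivationₗ κ b (quotientMap J ⁅x, y⁆) =
          -adDerivationₗ κ b (quotientMap J y) * -adDerivationₗ κ b (quotientMap J x) -
            -adDerivationₗ κ b (quotientMap J x) * -adDerivationₗ κ b (quotientMap J y)
        rw [LieHom.map_lie, adDerivationₗ_lie]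
        exact neg_mul_sub_mul_comm _ _ }
    fun x => by
      apply MulOpposite.unop_injective
      change -adDerivationₗ κ b (quotientMap J (RestrictedLieAlgebra.pMap p F x)) =
        (-adDerivationₗ κ b (quotientMap J x)) ^ p
      rw [adDerivationₗ_eq_pow b p (ad_quotientMap_pMap J x)]
      have : CharP (Module.End F (CopiesRing κ b)) p :=
        charP_of_injective_algebraMap (algebraMap F _).injective p
      -- Expanding (0 - D)^p gives (-D)^p = -D^p for p = 2 as well.
      have h := sub_pow_char_of_commute p
        (Commute.zero_left (adDerivationₗ κ b (quotientMap J x)))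
      rw [zero_sub, zero_pow (Fact.out : p.Prime).ne_zero, zero_sub] at h
      exact h.symm

theorem rightAdAction_ι {ι : Type*} (κ : Type*) (J : LieIdeal F L)
    (b : Module.Basis ι F (L ⧸ J)) (x : L) (f : CopiesRing κ b) :
    (rightAdAction κ J b (envelopingι p F x)).unop f =
      -adDerivation κ b (quotientMap J x) f := by
  rw [rightAdAction, envelopingLift_ι]
  rfl

theorem rightAdAction_of_invariant {ι : Type*} (κ : Type*) (J : LieIdeal F L)
    (b : Module.Basis ι F (L ⧸ J)) (f : CopiesRing κ b)
    (hf : ∀ x, adDerivation κ b x f = 0) (a : RestrictedEnvelopingAlgebra p F L) :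
    (rightAdAction κ J b a).unop f = augmentation p F L a • f := by
  induction a using enveloping_induction with
  | ι x => rw [rightAdAction_ι, hf, augmentation_ι, neg_zero, zero_smul]
  | algebraMap c =>
    rw [AlgHom.commutes, AlgHom.commutes]
    rfl
  | add a b ha hb => rw [map_add, map_add, MulOpposite.unop_add, LinearMap.add_apply, ha, hb,
      add_smul]
  | mul a b ha hb => rw [map_mul, map_mul, MulOpposite.unop_mul, Module.End.mul_apply, ha,
      map_smul, hb, smul_smul]

/-- If `S` is an abelian ideal of `L / J` that contains no non-zero central element, then every
central element of augmentation one acts on `S` as the identity. -/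
theorem rep_factor_eq_one [FiniteDimensional F L] (J I : LieIdeal F L)
    (hab : ∀ s ∈ factor J I, ∀ t ∈ factor J I, ⁅s, t⁆ = 0)
    (hS : ∀ s ∈ factor J I, (∀ w : L ⧸ J, ⁅s, w⁆ = 0) → s = 0)
    (h : IsRestrictedModule p F L (factor J I)) (e : RestrictedEnvelopingAlgebra p F L)
    (he : e ∈ Subring.center (RestrictedEnvelopingAlgebra p F L))
    (hε : augmentation p F L e = 1) : h.rep e = 1 := by
  have : FiniteDimensional F (L ⧸ J) :=
    Module.Finite.of_surjective (quotientMap J : L →ₗ[F] L ⧸ J) (quotientMap_surjective J)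
  let b := Module.finBasis F (L ⧸ J)
  refine LinearMap.ext fun s => ?_
  rw [Module.End.one_apply, ← sub_eq_zero, ← Module.forall_dual_apply_eq_zero_iff F]
  intro lam
  rw [map_sub, sub_eq_zero]
  obtain ⟨r, n, n₀, hn₀, hinv, hn⟩ := exists_adDerivation_eq_smul p b (factor J I) hab hS lam
  let R := rightAdAction (p := p) (Fin r) J b
  -- T y is the identity n·(yx) = -λ(y·s)n₀, with s the image of x in S.
  let T : RestrictedEnvelopingAlgebra p F L → Prop := fun y =>
    ∀ (x : L) (hx : quotientMap J x ∈ factor J I),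
      (R (y * envelopingι p F x)).unop n = -(lam (h.rep y ⟨quotientMap J x, hx⟩) • n₀)
  have hR : ∀ y (x : L), (R (y * envelopingι p F x)).unop n =
      -adDerivation (Fin r) b (quotientMap J x) ((R y).unop n) := by
    intro y x
    rw [map_mul, MulOpposite.unop_mul, Module.End.mul_apply, rightAdAction_ι]
  have hT1 : T 1 := by
    intro x hx
    rw [hR, map_one, map_one, MulOpposite.unop_one, Module.End.one_apply, Module.End.one_apply]
    exact congrArg _ (hn ⟨_, hx⟩)
  -- Having t arbitrary lets factors be appended on the right one at a time, which makes the product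
  -- case immediate.
  have hT : ∀ y t, T t → T (t * y) := by
    intro y
    induction y using enveloping_induction with
    | ι z =>
      intro t ht x hx
      have hzx : quotientMap J ⁅z, x⁆ ∈ factor J I := by
        rw [LieHom.map_lie]
        exact lie_mem_right F _ _ _ _ hx
      have h1 : t * envelopingι p F z * envelopingι p F x =
          t * envelopingι p F ⁅z, x⁆ + t * envelopingι p F x * envelopingι p F z := by
        rw [envelopingι_lie]; noncomm_ring
      -- By `ht`, n·(tx) is a multiple of the invariant n₀, which z kills.
      have h2 : (R (t * envelopingι p F x * envelopingι p F z)).unop n = 0 := by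
        rw [hR, ht x hx, map_neg, Derivation.map_smul, hinv, smul_zero, neg_zero, neg_zero]
      rw [h1, map_add, MulOpposite.unop_add, LinearMap.add_apply, h2, add_zero, ht _ hzx, map_mul,
        Module.End.mul_apply, h.rep_ι]
      congr 4
    | algebraMap c =>
      intro t ht x hx
      rw [← Algebra.commutes, ← Algebra.smul_def, smul_mul_assoc, map_smul, MulOpposite.unop_smul,
        LinearMap.smul_apply, ht x hx, map_smul, LinearMap.smul_apply, map_smul, smul_neg,
        smul_smul, smul_eq_mul]
    | add y z hy hz =>
      intro t ht x hx
      rw [mul_add, add_mul, map_add, MulOpposite.unop_add, LinearMap.add_apply, hy t ht x hx,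
        hz t ht x hx, map_add, LinearMap.add_apply, map_add, add_smul, neg_add]
    | mul y z hy hz =>
      intro t ht
      rw [← mul_assoc]
      exact hz _ (hy t ht)
  obtain ⟨q, hq⟩ := s
  obtain ⟨x, rfl⟩ := quotientMap_surjective J q
  have h1 := hT e 1 hT1 x hq
  -- Centrality replaces ex by xe; then e acts on the multiple n·x of n₀ through its augmentation.
  rw [one_mul, ← Subring.mem_center_iff.1 he, map_mul, MulOpposite.unop_mul,
    Module.End.mul_apply, ← one_mul (envelopingι p F x), hT1 x hq, map_neg, map_smul,
    rightAdAction_of_invariant _ _ _ _ hinv, hε, one_smul, map_one, Module.End.one_apply,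
    neg_inj] at h1
  exact (smul_left_injective F hn₀ h1).symm

end Main

end RestrictedLie

end

/-! ### The two cases: non-central and central chief factors -/

theorem proposition5p4 (p : ℕ) [Fact p.Prime] (F : Type*) [Field F] [CharP F p]
    (L : Type*) [LieRing L] [LieAlgebra F L] [FiniteDimensional F L]
    [RestrictedLie.RestrictedLieAlgebra p F L]
    (C : RestrictedLie.ChiefSeries F L) (j : Fin C.length)
    (hab : IsLieAbelian (C.chiefFactor j)) :
    RestrictedLie.BelongsToPrincipalBlock p F L (C.chiefFactor j) := by
  open RestrictedLie in
  have h := isRestrictedModule_factor p (C.ideal j.castSucc) (C.ideal j.succ)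
  obtain ⟨e, he, hε⟩ := exists_isBlockIdempotent_map_eq_one (augmentation p F L)
  refine ⟨h, e, he, ?_, ?_⟩
  · rw [IsRestrictedModule.rep_eq_augmentation _ fun x m => LieModule.IsTrivial.trivial x m, hε,
      map_one]
  set J := C.ideal j.castSucc
  set S := C.chiefFactor j
  have habS : ∀ s ∈ S, ∀ t ∈ S, ⁅s, t⁆ = 0 := fun s hs t ht =>
    congrArg Subtype.val (hab.trivial ⟨s, hs⟩ ⟨t, ht⟩)
  by_cases hS : ∀ s ∈ S, (∀ w : L ⧸ J, ⁅s, w⁆ = 0) → s = 0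
  · exact rep_factor_eq_one _ _ habS hS h e he.mem_center hε
  · push Not at hS
    obtain ⟨s, hs, hsc, hs0⟩ := hS
    have hle : S ≤ LieAlgebra.center F (L ⧸ J) := by
      -- The intersection is an ideal containing s ≠ 0, so minimality of S leaves only S itself.
      have hinf : S ⊓ LieAlgebra.center F (L ⧸ J) = S := by
        refine ((C.minimal j).le_iff.1 inf_le_left).resolve_left fun h0 => hs0 ?_
        have : s ∈ S ⊓ LieAlgebra.center F (L ⧸ J) :=
          ⟨hs, fun w => by rw [← lie_skew, hsc, neg_zero]⟩
        rw [h0] at this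
        simpa using this
      exact inf_eq_left.1 hinf
    rw [h.rep_eq_augmentation (fun x m => Subtype.ext ?_), hε, map_one]
    rw [coe_lie_factor]
    exact hle m.2 _
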